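/- Let $d\in\{2,3\}$. Let $\mathcal T^H=\{K_i\}_{i=1}^N$ be a finite family of convex polytopes in $\mathbb R^d$ with nonempty, pairwise disjoint interiors, let $D$ be the interior of $\bigcup_iK_i$, and let $\mathcal T^h$ be a second such partition that refines $\mathcal T^H$ (every fine cell lies in a coarse cell and every coarse cell is a union of fine cells). Let $\kappa:\mathbb R^d\to\mathbb R$ be measurable with $0<\kappa_{\min}\le\kappa\le\kappa_{\max}$ a.e. in $D$, and let $f\in L^2(D)$ with $\int_Df\,dx=0$. Put $V_0=\{v\in H(\mathrm{div};D): v\cdot\mathbf n=0\text{ on }\partial D\}$, $Q=L^2(D)$, $$a(v,w)=\int_D\kappa^{-1}v\cdot w\,dx,\qquad b(w,q)=\int_Dq\,\nabla\cdot w\,dx,\qquad (p,q)=\int_Dpq\,dx,$$ and let $Q_H$ be the space of $q\in Q$ with $\int_Dq\,dx=0$ that are constant on each $K\in\mathcal T^H$. Normal traces are understood through Green's formula. Let $\{E_\ell\}_{\ell=1}^{N_e}$ be the interior coarse faces, i.e. the intersections of two distinct coarse cells that have positive $(d-1)$-dimensional measure. Let $\mathbf m_\ell$ be a fixed unit normal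 of $E_\ell$, let $\omega_\ell=\bigcup\{K\in\mathcal T^H:E_\ell\subset K\}$, and let $e_1,\dots,e_{J_\ell}$ be the fine faces contained in $E_\ell$ (intersections of two distinct fine cells, of positive $(d-1)$-dimensional measure). Let $\delta_j^\ell=|e_j|^{-1}$ on $e_j$ and $\delta_j^\ell=0$ elsewhere on $E_\ell$. *Snapshots.* For each $\ell,j$ let $(\psi_{snap}^{\ell,j},p_{snap}^{\ell,j})\in V_0\times Q$ vanish outside $\omega_\ell$ and satisfy, on each coarse cell $K\subset\omega_\ell$ with outward unit normal $\mathbf n_K$: $\int_Kp_{snap}^{\ell,j}dx=0$, $\kappa^{-1}\psi_{snap}^{\ell,j}+\nabla p_{snap}^{\ell,j}=0$ weakly in $K$, $\nabla\cdot\psi_{snap}^{\ell,j}=\alpha_K:=(\mathbf m_\ell\cdot\mathbf n_K|_{E_\ell})\,|K|^{-1}\int_{E_\ell}\delta_j^\ell\,dS$ in $K$, $\psi_{snap}^{\ell,j}\cdot\mathbf m_\ell=\delta_j^\ell$ on $E_\ell$, and $\psi_{snap}^{\ell,j}\cdot\mathbf n_K=0$ on $\partial K\setminus E_\ell$. Put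 $V_{snap}^{(\ell)}=\mathrm{span}\{\psi_{snap}^{\ell,j}\}_j$, $V_{snap}=\sum_\ell V_{snap}^{(\ell)}$ and $V_{snap,2}^{(\ell)}=\{v\in V_{snap}^{(\ell)}:\int_{E_\ell}v\cdot\mathbf m_\ell\,dS=0\}$. *Basis functions.* Let $\varphi_1^{\ell}\in V_{snap}^{(\ell)}$ with $\varphi_1^\ell\cdot\mathbf m_\ell=1$ on $E_\ell$. For $v\in V_{snap,2}^{(\ell)}$ let $\mathcal H_\ell(v)$ be the minimizer of $\int_{\omega_\ell}\kappa^{-1}|w|^2dx$ over all restrictions $w$ to $\omega_\ell$ of elements of $V_{snap}$ with $w\cdot\mathbf m_\ell=v\cdot\mathbf m_\ell$ on $E_\ell$. Let $\varphi_2^{\ell,1},\dots,\varphi_2^{\ell,n_\ell}$ be a basis of $V_{snap,2}^{(\ell)}$ of solutions of the eigenvalue problem $$\int_{\omega_\ell}\kappa^{-1}\mathcal H_\ell(\varphi_2^{\ell,j})\cdot\mathcal H_\ell(v)\,dx=\sigma_j^{(\ell)}\int_{\omega_\ell}\kappa^{-1}\varphi_2^{\ell,j}\cdot v\,dx\quad\forall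 v\in V_{snap,2}^{(\ell)},\qquad \sigma_1^{(\ell)}\le\dots\le\sigma_{n_\ell}^{(\ell)},$$ let $0\le\mathcal J_{\ell,2}\le n_\ell$, $V_{sms}^{(\ell)}=\mathrm{span}\{\varphi_2^{\ell,j}\}_{j\le\mathcal J_{\ell,2}}$, let $\tilde V_{sms}^{(\ell)}$ be the $a$-orthogonal complement of $V_{sms}^{(\ell)}$ in $V_{snap,2}^{(\ell)}$, and $\tilde V_{sms}=\sum_\ell\tilde V_{sms}^{(\ell)}$. Denote by $\varphi_j^{(\ell)}$, $1\le j\le 1+\mathcal J_{\ell,2}$, the functions $\varphi_1^\ell,\varphi_2^{\ell,1},\dots,\varphi_2^{\ell,\mathcal J_{\ell,2}}$. Let the corrector $\tilde\psi_{ms,j}^{(\ell)}\in\tilde V_{sms}$ solve $$a(\tilde\psi_{ms,j}^{(\ell)},v)=-a(\varphi_j^{(\ell)},v)\quad\forall v\in\tilde V_{sms},$$ and put $\psi_{ms,j}^{(\ell)}=\tilde\psi_{ms,j}^{(\ell)}+\varphi_j^{(\ell)}$ and $V_{glo}=\mathrm{span}\{\psi_{ms,j}^{(\ell)}\}_{\ell,j}$.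 *Claim.* If $(u_{snap},p_{snap})\in V_{snap}\times Q_H$ satisfies $$a(u_{snap},v)-b(v,p_{snap})=0\ \ \forall v\in V_{snap},\qquad b(u_{snap},q)=(f,q)\ \ \forall q\in Q_H,$$ and $(u_{glo},p_{glo})\in V_{glo}\times Q_H$ satisfies $$a(u_{glo},v)-b(v,p_{glo})=0\ \ \forall v\in V_{glo},\qquad b(u_{glo},q)=(f,q)\ \ \forall q\in Q_H,$$ then $u_{snap}=u_{glo}$. -/

import Mathlib

open MeasureTheory Set

/-- Euclidean space of dimension `d`. -/
abbrev Euc (d : ℕ) : Type := EuclideanSpace ℝ (Fin d)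

/-- A finite family of convex polytopes (each with nonempty interior) whose interiors are pairwise
disjoint, i.e. a polytopal partition of their union. -/
structure PolytopalPartition (d : ℕ) where
  N : ℕ
  cell : Fin N → Set (Euc d)
  polytope : ∀ i, ∃ s : Finset (Euc d), cell i = convexHull ℝ (s : Set (Euc d))
  interior_nonempty : ∀ i, (interior (cell i)).Nonempty
  interior_disjoint : ∀ i j, i ≠ j → Disjoint (interior (cell i)) (interior (cell j))

/-- An interior face of the partition: the intersection of two distinct cells, if it has positive
`(d-1)`-dimensional measure. Here `μHE[d-1]` is the surface measure (Hausdorff measure normalised so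
that it is Lebesgue measure on `(d-1)`-dimensional Euclidean spaces). -/
def PolytopalPartition.IsFace {d : ℕ} (P : PolytopalPartition d) (E : Set (Euc d)) : Prop :=
  ∃ i j, i ≠ j ∧ E = P.cell i ∩ P.cell j ∧ 0 < (μHE[d - 1] : Measure (Euc d)) E

/-- A coarse partition together with a fine partition that refines it. -/
structure TwoGrid (d : ℕ) where
  coarse : PolytopalPartition d
  fine : PolytopalPartition d
  fine_sub : ∀ t, ∃ i, fine.cell t ⊆ coarse.cell i
  coarse_eq : ∀ i, coarse.cell i = ⋃ t ∈ {t | fine.cell t ⊆ coarse.cell i}, fine.cell t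

/-- Smooth compactly supported test functions on `ℝᵈ`. -/
def IsTest {d : ℕ} (φ : Euc d → ℝ) : Prop :=
  ContDiff ℝ (⊤ : ℕ∞) φ ∧ HasCompactSupport φ

namespace TwoGrid

variable {d : ℕ} (G : TwoGrid d)

/-- The coarse element with index `i`. -/
abbrev K (i : Fin G.coarse.N) : Set (Euc d) := G.coarse.cell i

/-- The computational domain `D`, an open polyhedral set partitioned by the coarse elements. -/
def domain : Set (Euc d) := interior (⋃ i, G.K i)

/-- Lebesgue measure on `D`. -/
noncomputable def vol : Measure (Euc d) := volume.restrict G.domain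

/-- Surface measure. -/
noncomputable def surf (_G : TwoGrid d) : Measure (Euc d) := μHE[d - 1]

/-- Vector fields in `L²(D; ℝᵈ)`. -/
abbrev VecL2 : Type := Lp (Euc d) 2 G.vol

/-- `Q = L²(D)`. -/
abbrev Q : Type := Lp ℝ 2 G.vol

/-! ### `H(div; D)`, traces and bilinear forms -/

/-- `g` is the weak divergence of `v` in `D`. -/
def IsWeakDiv (v : G.VecL2) (g : G.Q) : Prop :=
  ∀ φ : Euc d → ℝ, IsTest φ → tsupport φ ⊆ G.domain →
    ∫ x, inner ℝ (v x) (gradient φ x) ∂G.vol = -∫ x, g x * φ x ∂G.vol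

/-- `V = H(div; D)`. -/
def Hdiv : Set G.VecL2 := {v | ∃ g, G.IsWeakDiv v g}

open Classical in
/-- The weak divergence of `v ∈ H(div; D)` (and `0` for other `v`). -/
noncomputable def weakDiv (v : G.VecL2) : G.Q :=
  if h : ∃ g, G.IsWeakDiv v g then h.choose else 0

/-- `V₀ = {v ∈ H(div; D) : v · n = 0 on ∂D}`, where the boundary condition is understood through
Green's formula. -/
def V₀ : Set G.VecL2 :=
  {v | v ∈ G.Hdiv ∧ ∀ φ : Euc d → ℝ, IsTest φ →
    ∫ x, (inner ℝ (v x) (gradient φ x) + G.weakDiv v x * φ x) ∂G.vol = 0}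

/-- For `v ∈ H(div; D)`, the normal trace `v · n` on `∂K i`, with `n` the outward unit normal of
`K i`, is the integrable function `γ` on `∂K i` (Green's formula). -/
def HasNormalTrace (i : Fin G.coarse.N) (v : G.VecL2) (γ : Euc d → ℝ) : Prop :=
  IntegrableOn γ (frontier (G.K i)) G.surf ∧
  ∀ φ : Euc d → ℝ, IsTest φ →
    ∫ x in G.K i, (inner ℝ (v x) (gradient φ x) + G.weakDiv v x * φ x) ∂G.vol
      = ∫ x in frontier (G.K i), γ x * φ x ∂G.surf

/-- `∫_S κ⁻¹ v · w dx`. -/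
noncomputable def aOn (κ : Euc d → ℝ) (S : Set (Euc d)) (v w : G.VecL2) : ℝ :=
  ∫ x in S, (κ x)⁻¹ * inner ℝ (v x) (w x) ∂G.vol

/-- `a(v, w) = ∫_D κ⁻¹ v · w dx`. -/
noncomputable def a (κ : Euc d → ℝ) (v w : G.VecL2) : ℝ :=
  ∫ x, (κ x)⁻¹ * inner ℝ (v x) (w x) ∂G.vol

/-- `b(w, q) = ∫_D q ∇·w dx`. -/
noncomputable def b (w : G.VecL2) (q : G.Q) : ℝ := ∫ x, q x * G.weakDiv w x ∂G.vol

/-- `Q_H`: functions of zero mean that are constant on each coarse element. -/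
def QH : Set G.Q :=
  {q | ∫ x, q x ∂G.vol = 0 ∧ ∀ i, ∃ c : ℝ, ∀ᵐ x ∂G.vol, x ∈ G.K i → q x = c}

/-! ### Faces and coarse neighbourhoods -/

/-- Interior coarse faces. -/
abbrev CoarseFace : Type := {E : Set (Euc d) // G.coarse.IsFace E}

/-- Fine faces lying on the coarse face `E`. -/
abbrev FineFace (E : G.CoarseFace) : Type :=
  {e : Set (Euc d) // G.fine.IsFace e ∧ e ⊆ (E : Set (Euc d))}

/-- The coarse neighbourhood `ω_E`: the union of the coarse elements that contain `E`. -/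
def nbhd (E : G.CoarseFace) : Set (Euc d) := ⋃ i ∈ {i | (E : Set (Euc d)) ⊆ G.K i}, G.K i

/-- `m` is a unit vector orthogonal to the face `E`. -/
def IsUnitNormal (E : G.CoarseFace) (m : Euc d) : Prop :=
  ‖m‖ = 1 ∧ ∀ x ∈ (E : Set (Euc d)), ∀ y ∈ (E : Set (Euc d)), inner ℝ m (x - y) = 0

open Classical in
/-- For a coarse element `K i` containing `E` and a unit normal `m` of `E`, this is
`m · n` on `E`, where `n` is the outward unit normal of `K i`; it is `1` or `-1`. -/
noncomputable def outSign (i : Fin G.coarse.N) (E : G.CoarseFace) (m : Euc d) : ℝ :=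
  if ∀ x ∈ G.K i, ∀ y ∈ (E : Set (Euc d)), inner ℝ m (x - y) ≤ 0 then 1 else -1

/-- `v · m = g` on `E`, for `v ∈ H(div; D)` with integrable normal traces on the boundaries of the
coarse elements that contain `E`. -/
def HasNormalComponent (E : G.CoarseFace) (m : Euc d) (v : G.VecL2) (g : Euc d → ℝ) : Prop :=
  ∀ i, (E : Set (Euc d)) ⊆ G.K i → ∃ γ : Euc d → ℝ, G.HasNormalTrace i v γ ∧
    ∀ᵐ x ∂(G.surf.restrict (E : Set (Euc d))), γ x = G.outSign i E m * g x

/-! ### Snapshot spaces -/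

/-- The flux datum `|e|⁻¹` on the fine face `e` and `0` elsewhere. -/
noncomputable def fluxDatum {E : G.CoarseFace} (e : G.FineFace E) : Euc d → ℝ :=
  (e : Set (Euc d)).indicator fun _ => (G.surf (e : Set (Euc d))).toReal⁻¹

/-- `(ψ, p)` (extended by zero outside `ω_E`) is the snapshot pair of the fine face `e ⊆ E`:
`ψ` is in `V₀`, `p` has zero mean on the coarse elements of `ω_E`, and on each such element
`κ⁻¹ ψ + ∇p = 0` weakly, `∇·ψ` is the constant that is compatible with the fluxes, `ψ · m` is the
flux datum on `E`, and `ψ · n = 0` on the remaining part of the boundary. -/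
structure IsSnapshot (κ : Euc d → ℝ) (E : G.CoarseFace) (m : Euc d) (e : G.FineFace E)
    (ψ : G.VecL2) (p : G.Q) : Prop where
  mem_V₀ : ψ ∈ G.V₀
  velocity_support : ∀ᵐ x ∂G.vol, x ∉ G.nbhd E → ψ x = 0
  pressure_support : ∀ᵐ x ∂G.vol, x ∉ G.nbhd E → p x = 0
  pressure_mean : ∀ i, (E : Set (Euc d)) ⊆ G.K i → ∫ x in G.K i, p x ∂G.vol = 0
  darcy : ∀ i, (E : Set (Euc d)) ⊆ G.K i → ∀ φ : Euc d → ℝ, IsTest φ →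
    tsupport φ ⊆ interior (G.K i) → ∀ c : Euc d,
      ∫ x in G.K i, (κ x)⁻¹ * inner ℝ (ψ x) c * φ x ∂G.vol
        = ∫ x in G.K i, p x * inner ℝ (gradient φ x) c ∂G.vol
  divergence : ∀ i, (E : Set (Euc d)) ⊆ G.K i → ∀ᵐ x ∂G.vol, x ∈ G.K i →
    G.weakDiv ψ x = (volume (G.K i)).toReal⁻¹ *
      (G.outSign i E m * ∫ y in (E : Set (Euc d)), G.fluxDatum e y ∂G.surf)
  normal_trace : ∀ i, (E : Set (Euc d)) ⊆ G.K i →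
    G.HasNormalTrace i ψ
      ((E : Set (Euc d)).indicator fun x => G.outSign i E m * G.fluxDatum e x)

/-- The local snapshot space of the face `E`, spanned by the snapshot velocities. -/
noncomputable def VsnapLoc (ψ : ∀ E : G.CoarseFace, G.FineFace E → G.VecL2) (E : G.CoarseFace) :
    Submodule ℝ G.VecL2 :=
  Submodule.span ℝ (range (ψ E))

/-- `V_snap`, the sum of the local snapshot spaces. -/
noncomputable def Vsnap (ψ : ∀ E : G.CoarseFace, G.FineFace E → G.VecL2) : Submodule ℝ G.VecL2 :=
  ⨆ E, G.VsnapLoc ψ E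

/-- `V_{snap,2}` of the face `E`: local snapshots with zero total flux through `E`. -/
noncomputable def Vsnap2Loc (m : G.CoarseFace → Euc d) (ψ : ∀ E : G.CoarseFace, G.FineFace E → G.VecL2)
    (E : G.CoarseFace) : Submodule ℝ G.VecL2 :=
  Submodule.span ℝ {v | v ∈ G.VsnapLoc ψ E ∧ ∃ g : Euc d → ℝ,
    G.HasNormalComponent E (m E) v g ∧ ∫ x in (E : Set (Euc d)), g x ∂G.surf = 0}

/-! ### The spectral problem -/

/-- `h`, supported in `ω_E`, is the restriction to `ω_E` of some `w ∈ V_snap` with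
`w · m = v · m` on `E`. -/
def IsAdmissible (m : G.CoarseFace → Euc d) (ψ : ∀ E : G.CoarseFace, G.FineFace E → G.VecL2)
    (E : G.CoarseFace) (v h : G.VecL2) : Prop :=
  ∃ w ∈ G.Vsnap ψ, (∀ᵐ x ∂G.vol, h x = (G.nbhd E).indicator w x) ∧
    G.HasNormalComponent E (m E) (w - v) 0

/-- `h` minimises the energy among the admissible fields. -/
def IsMinimalExtension (κ : Euc d → ℝ) (m : G.CoarseFace → Euc d)
    (ψ : ∀ E : G.CoarseFace, G.FineFace E → G.VecL2) (E : G.CoarseFace) (v h : G.VecL2) : Prop :=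
  G.IsAdmissible m ψ E v h ∧ ∀ h', G.IsAdmissible m ψ E v h' → G.a κ h h ≤ G.a κ h' h'

open Classical in
/-- The operator `𝓗_E` sending `v` to the energy minimising admissible field. -/
noncomputable def minExt (κ : Euc d → ℝ) (m : G.CoarseFace → Euc d)
    (ψ : ∀ E : G.CoarseFace, G.FineFace E → G.VecL2) (E : G.CoarseFace) (v : G.VecL2) : G.VecL2 :=
  if h : ∃ u, G.IsMinimalExtension κ m ψ E v u then h.choose else 0

/-- `(φ, σ)` satisfies the local spectral problem of the face `E`. -/
def IsEigenpair (κ : Euc d → ℝ) (m : G.CoarseFace → Euc d)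
    (ψ : ∀ E : G.CoarseFace, G.FineFace E → G.VecL2) (E : G.CoarseFace)
    (φ : G.VecL2) (σ : ℝ) : Prop :=
  φ ∈ G.Vsnap2Loc m ψ E ∧ ∀ v ∈ G.Vsnap2Loc m ψ E,
    G.aOn κ (G.nbhd E) (G.minExt κ m ψ E φ) (G.minExt κ m ψ E v)
      = σ * G.aOn κ (G.nbhd E) φ v

/-- The choices made in the offline stage for each coarse face: `φ₁` is the local snapshot with unit
normal flux on the face, `φ₂` is a basis of `V_{snap,2}` of the face made of eigenfunctions with
ascending eigenvalues `σ`, and the first `J` of them are selected. -/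
structure OfflineBasis (κ : Euc d → ℝ) (m : G.CoarseFace → Euc d)
    (ψ : ∀ E : G.CoarseFace, G.FineFace E → G.VecL2) where
  φ₁ : G.CoarseFace → G.VecL2
  φ₁_mem : ∀ E, φ₁ E ∈ G.VsnapLoc ψ E
  φ₁_flux : ∀ E, G.HasNormalComponent E (m E) (φ₁ E) 1
  n : G.CoarseFace → ℕ
  φ₂ : ∀ E, Fin (n E) → G.VecL2
  σ : ∀ E, Fin (n E) → ℝ
  eigen : ∀ E j, G.IsEigenpair κ m ψ E (φ₂ E j) (σ E j)
  σ_mono : ∀ E, Monotone (σ E)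
  linInd : ∀ E, LinearIndependent ℝ (φ₂ E)
  span_eq : ∀ E, Submodule.span ℝ (range (φ₂ E)) = G.Vsnap2Loc m ψ E
  J : G.CoarseFace → ℕ
  J_le : ∀ E, J E ≤ n E

namespace OfflineBasis

variable {G} {κ : Euc d → ℝ} {m : G.CoarseFace → Euc d}
  {ψ : ∀ E : G.CoarseFace, G.FineFace E → G.VecL2} (B : OfflineBasis G κ m ψ)

/-- The basis functions `φ_j` of the face `E`: the function `φ₁` and the first `J` eigenfunctions. -/
def basisFn (E : G.CoarseFace) : Option (Fin (B.J E)) → G.VecL2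
  | none => B.φ₁ E
  | some j => B.φ₂ E (Fin.castLE (B.J_le E) j)

/-- `V_sms` of the face `E`, spanned by the first `J` eigenfunctions. -/
noncomputable def VsmsLoc (E : G.CoarseFace) : Submodule ℝ G.VecL2 :=
  Submodule.span ℝ (range fun j : Fin (B.J E) => B.φ₂ E (Fin.castLE (B.J_le E) j))

/-- The `a`-orthogonal complement of `V_sms` in `V_{snap,2}`, for the face `E`. -/
noncomputable def VsmsTildeLoc (E : G.CoarseFace) : Submodule ℝ G.VecL2 :=
  Submodule.span ℝ {v | v ∈ G.Vsnap2Loc m ψ E ∧ ∀ w ∈ B.VsmsLoc E, G.a κ v w = 0}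

/-- The sum over all faces of these complements. -/
noncomputable def VsmsTilde : Submodule ℝ G.VecL2 := ⨆ E, B.VsmsTildeLoc E

/-- `c` is the family of correctors of the basis functions. -/
def IsCorrector (c : ∀ E : G.CoarseFace, Option (Fin (B.J E)) → G.VecL2) : Prop :=
  ∀ E j, c E j ∈ B.VsmsTilde ∧ ∀ v ∈ B.VsmsTilde, G.a κ (c E j) v = -G.a κ (B.basisFn E j) v

/-- `V_glo`, spanned by the corrected basis functions. -/
noncomputable def Vglo (c : ∀ E : G.CoarseFace, Option (Fin (B.J E)) → G.VecL2) : Submodule ℝ G.VecL2 :=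
  Submodule.span ℝ {v | ∃ E j, v = c E j + B.basisFn E j}

end OfflineBasis

/-- `(u, p) ∈ W × Q_H` solves the mixed problem with velocity space `W` and source `f`. -/
def IsMixedSolution (κ : Euc d → ℝ) (f : G.Q) (W : Submodule ℝ G.VecL2) (u : G.VecL2) (p : G.Q) :
    Prop :=
  u ∈ W ∧ p ∈ G.QH ∧ (∀ v ∈ W, G.a κ u v - G.b v p = 0) ∧
    ∀ q ∈ G.QH, G.b u q = ∫ x, f x * q x ∂G.vol

end TwoGrid

/-! The proof rests on a splitting of `Vsnap` into `Vglo` and a space `VsmsTilde` that is divergence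
free and `a`-orthogonal to `Vglo`. Orthogonality is the corrector equation
(`IsCorrector.a_eq_zero`). The splitting (`IsCorrector.Vsnap_le_Vglo_sup_VsmsTilde`) is assembled
face by face: a local snapshot minus a multiple of `φ₁` has zero total flux, a zero-flux snapshot
splits by `a`-projection onto `VsmsLoc`, and a basis function differs from its corrected version by
an element of `VsmsTilde`. Zero flux forces zero divergence, because the divergence of a snapshot on
each cell is a constant proportional to its flux (`IsBalanced.weakDiv_eq_zero`).

Write `u_snap = v + t` along the splitting. Testing the snapshot system with `t` removes the
pressure and leaves `a t t = 0`, so `t = 0` and `u_snap` lies in `Vglo`. The difference of the two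
velocities is then an admissible test field in both systems, and `b` of it vanishes against `QH`;
hence its energy is zero.

Most of the preparation makes divergence and normal flux usable: `weakDiv` is a chosen witness and
fluxes are given by Green's formula, so uniqueness has to come before linearity of the divergence
and before the flux is well defined. -/

namespace IsTest

/-! ### Square integrability of test functions and their gradients. -/

variable {d : ℕ} {φ : Euc d → ℝ}

theorem continuous_gradient (hφ : IsTest φ) : Continuous (gradient φ) :=
  (InnerProductSpace.toDual ℝ (Euc d)).symm.continuous.comp
    (hφ.1.continuous_fderiv (by simp))

theorem hasCompactSupport_gradient (hφ : IsTest φ) : HasCompactSupport (gradient φ) :=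
  (hφ.2.fderiv ℝ).comp_left (g := (InnerProductSpace.toDual ℝ (Euc d)).symm) (map_zero _)

theorem memLp (hφ : IsTest φ) (μ : Measure (Euc d)) [IsFiniteMeasureOnCompacts μ] :
    MemLp φ 2 μ :=
  hφ.1.continuous.memLp_of_hasCompactSupport hφ.2

theorem memLp_gradient (hφ : IsTest φ) (μ : Measure (Euc d)) [IsFiniteMeasureOnCompacts μ] :
    MemLp (gradient φ) 2 μ :=
  hφ.continuous_gradient.memLp_of_hasCompactSupport hφ.hasCompactSupport_gradient

end IsTest

/-- A symmetric positive definite form on a real vector space splits off every finite-dimensional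
subspace. -/
theorem LinearMap.BilinForm.exists_mem_forall_sub_eq_zero {V : Type*} [AddCommGroup V] [Module ℝ V]
    (A : LinearMap.BilinForm ℝ V) (hp : ∀ v, A v v = 0 → v = 0)
    (W : Submodule ℝ V) [FiniteDimensional ℝ W] (v : V) :
    ∃ w ∈ W, ∀ u ∈ W, A (v - w) u = 0 := by
  have hnd : (A.restrict W).Nondegenerate := by
    refine ⟨fun x h => ?_, fun x h => ?_⟩ <;> exact Subtype.ext (hp x (h x))
  -- `w` represents the functional `A v` on `W`; nondegeneracy on `W` holds because each vector can
  -- be paired with itself.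
  let w := (LinearMap.BilinForm.toDual (A.restrict W) hnd).symm ((A v).domRestrict W)
  refine ⟨w, w.2, fun u hu => ?_⟩
  have h : A w u = A v u :=
    LinearMap.BilinForm.apply_toDual_symm_apply (hB := hnd) ((A v).domRestrict W) ⟨u, hu⟩
  rw [map_sub, LinearMap.sub_apply, h, sub_self]

/-! ### Topology of cells and faces. -/

namespace PolytopalPartition

variable {d : ℕ} (P : PolytopalPartition d)

theorem isCompact_cell (i : Fin P.N) : IsCompact (P.cell i) := by
  obtain ⟨s, hs⟩ := P.polytope i
  rw [hs]
  exact s.finite_toSet.isCompact_convexHull ℝ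

theorem convex_cell (i : Fin P.N) : Convex ℝ (P.cell i) := by
  obtain ⟨s, hs⟩ := P.polytope i
  rw [hs]
  exact convex_convexHull ℝ _

theorem cell_subset_closure_interior (i : Fin P.N) : P.cell i ⊆ closure (interior (P.cell i)) := by
  rw [(P.convex_cell i).closure_interior_eq_closure_of_nonempty_interior (P.interior_nonempty i)]
  exact subset_closure

/-- An open set that misses the interior of a cell misses its closure, which contains the whole
convex cell. -/
theorem disjoint_interior_cell {i j : Fin P.N} (h : i ≠ j) :
    Disjoint (interior (P.cell i)) (P.cell j) :=
  ((P.interior_disjoint i j h).closure_right isOpen_interior).mono_right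
    (P.cell_subset_closure_interior j)

theorem cell_inter_cell_subset_frontier {i j : Fin P.N} (h : i ≠ j) :
    P.cell i ∩ P.cell j ⊆ frontier (P.cell i) := fun _ hx =>
  ⟨subset_closure hx.1, fun hi => disjoint_left.1 (P.disjoint_interior_cell h) hi hx.2⟩

variable {P}

theorem IsFace.isClosed {E : Set (Euc d)} (hE : P.IsFace E) : IsClosed E := by
  obtain ⟨i, j, -, rfl, -⟩ := hE
  exact (P.isCompact_cell i).isClosed.inter (P.isCompact_cell j).isClosed

/-- Provides a cell on which `HasNormalComponent` is not vacuous, with the face inside the boundary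
that carries the trace. -/
theorem IsFace.exists_cell {E : Set (Euc d)} (hE : P.IsFace E) :
    ∃ i, E ⊆ P.cell i ∧ E ⊆ frontier (P.cell i) := by
  obtain ⟨i, j, hij, rfl, -⟩ := hE
  exact ⟨i, inter_subset_left, P.cell_inter_cell_subset_frontier hij⟩

theorem IsFace.measure_pos {E : Set (Euc d)} (hE : P.IsFace E) :
    0 < (μHE[d - 1] : Measure (Euc d)) E := by
  obtain ⟨_, _, _, _, h⟩ := hE
  exact h

end PolytopalPartition

namespace TwoGrid

variable {d : ℕ} {G : TwoGrid d}

instance : IsFiniteMeasureOnCompacts G.vol :=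
  inferInstanceAs (IsFiniteMeasureOnCompacts (volume.restrict G.domain))

theorem isOpen_domain (G : TwoGrid d) : IsOpen G.domain := isOpen_interior

theorem ae_mem_domain (G : TwoGrid d) : ∀ᵐ x ∂G.vol, x ∈ G.domain :=
  ae_restrict_mem G.isOpen_domain.measurableSet

/-! ### Weak divergence -/

theorem integrable_inner_of_memLp (v : G.VecL2) {g : Euc d → Euc d} (hg : MemLp g 2 G.vol) :
    Integrable (fun x => inner ℝ (v x) (g x)) G.vol := by
  refine (L2.integrable_inner (𝕜 := ℝ) v (hg.toLp g)).congr ?_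
  filter_upwards [hg.coeFn_toLp] with x hx
  rw [hx]

theorem integrable_mul_of_memLp (p : G.Q) {g : Euc d → ℝ} (hg : MemLp g 2 G.vol) :
    Integrable (fun x => p x * g x) G.vol :=
  (Lp.memLp p).integrable_mul hg

theorem integrable_inner_gradient (v : G.VecL2) {φ : Euc d → ℝ} (hφ : IsTest φ) :
    Integrable (fun x => inner ℝ (v x) (gradient φ x)) G.vol :=
  integrable_inner_of_memLp v (hφ.memLp_gradient _)

theorem integrable_mul_test (p : G.Q) {φ : Euc d → ℝ} (hφ : IsTest φ) :
    Integrable (fun x => p x * φ x) G.vol :=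
  integrable_mul_of_memLp p (hφ.memLp _)

theorem locallyIntegrable_coe (p : G.Q) : LocallyIntegrable p G.vol :=
  (Lp.memLp p).locallyIntegrable (by norm_num)

/-- The fundamental lemma of the calculus of variations, localized to an open set. -/
theorem ae_eq_zero_of_integral_test_eq_zero (p : G.Q) {U : Set (Euc d)} (hU : IsOpen U)
    (h : ∀ φ, IsTest φ → tsupport φ ⊆ U → ∫ x, p x * φ x ∂G.vol = 0) :
    ∀ᵐ x ∂G.vol, x ∈ U → p x = 0 := by
  refine hU.ae_eq_zero_of_integral_contDiff_smul_eq_zero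
    ((locallyIntegrable_coe p).locallyIntegrableOn _) fun φ h1 h2 h3 => ?_
  rw [← h φ ⟨h1, h2⟩ h3]
  simp only [smul_eq_mul, mul_comm]

theorem IsWeakDiv.add {v w : G.VecL2} {p q : G.Q} (hv : G.IsWeakDiv v p) (hw : G.IsWeakDiv w q) :
    G.IsWeakDiv (v + w) (p + q) := fun φ hφ hs => by
  have h1 : ∫ x, inner ℝ ((v + w : G.VecL2) x) (gradient φ x) ∂G.vol
      = ∫ x, (inner ℝ (v x) (gradient φ x) + inner ℝ (w x) (gradient φ x)) ∂G.vol := by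
    refine integral_congr_ae ?_
    filter_upwards [Lp.coeFn_add v w] with x hx
    rw [hx, Pi.add_apply, inner_add_left]
  have h2 : ∫ x, (p + q : G.Q) x * φ x ∂G.vol = ∫ x, (p x * φ x + q x * φ x) ∂G.vol := by
    refine integral_congr_ae ?_
    filter_upwards [Lp.coeFn_add p q] with x hx
    rw [hx, Pi.add_apply, add_mul]
  rw [h1, h2, integral_add (integrable_inner_gradient v hφ) (integrable_inner_gradient w hφ),
    integral_add (integrable_mul_test p hφ) (integrable_mul_test q hφ), hv φ hφ hs, hw φ hφ hs,
    neg_add]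

theorem IsWeakDiv.smul {v : G.VecL2} {p : G.Q} (c : ℝ) (hv : G.IsWeakDiv v p) :
    G.IsWeakDiv (c • v) (c • p) := fun φ hφ hs => by
  have h1 : ∫ x, inner ℝ ((c • v : G.VecL2) x) (gradient φ x) ∂G.vol
      = ∫ x, c * inner ℝ (v x) (gradient φ x) ∂G.vol := by
    refine integral_congr_ae ?_
    filter_upwards [Lp.coeFn_smul c v] with x hx
    rw [hx, Pi.smul_apply, real_inner_smul_left]
  have h2 : ∫ x, (c • p : G.Q) x * φ x ∂G.vol = ∫ x, c * (p x * φ x) ∂G.vol := by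
    refine integral_congr_ae ?_
    filter_upwards [Lp.coeFn_smul c p] with x hx
    rw [hx, Pi.smul_apply, smul_eq_mul, mul_assoc]
  rw [h1, h2, integral_const_mul, integral_const_mul, hv φ hφ hs, mul_neg]

theorem isWeakDiv_zero (G : TwoGrid d) : G.IsWeakDiv 0 0 := fun φ _ _ => by
  have h1 : ∫ x, inner ℝ ((0 : G.VecL2) x) (gradient φ x) ∂G.vol = 0 := by
    refine integral_eq_zero_of_ae ?_
    filter_upwards [Lp.coeFn_zero (Euc d) 2 G.vol] with x hx
    rw [hx]
    simp
  have h2 : ∫ x, (0 : G.Q) x * φ x ∂G.vol = 0 := by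
    refine integral_eq_zero_of_ae ?_
    filter_upwards [Lp.coeFn_zero ℝ 2 G.vol] with x hx
    rw [hx]
    simp
  rw [h1, h2, neg_zero]

theorem IsWeakDiv.eq_zero {p : G.Q} (h : G.IsWeakDiv 0 p) : p = 0 := by
  rw [Lp.eq_zero_iff_ae_eq_zero]
  have := ae_eq_zero_of_integral_test_eq_zero p G.isOpen_domain fun φ hφ hs => by
    have h0 : ∫ x, inner ℝ ((0 : G.VecL2) x) (gradient φ x) ∂G.vol = 0 := by
      refine integral_eq_zero_of_ae ?_
      filter_upwards [Lp.coeFn_zero (Euc d) 2 G.vol] with x hx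
      rw [hx]
      simp
    linarith [h φ hφ hs]
  filter_upwards [this, G.ae_mem_domain] with x hx hd using hx hd

/-- This makes the chosen `weakDiv` independent of the choice, hence linear on `HdivSubmodule`. -/
theorem IsWeakDiv.unique {v : G.VecL2} {p q : G.Q} (hp : G.IsWeakDiv v p)
    (hq : G.IsWeakDiv v q) : p = q := by
  have h := hp.add (hq.smul (-1))
  rw [neg_one_smul, neg_one_smul, ← sub_eq_add_neg, ← sub_eq_add_neg, sub_self] at h
  exact sub_eq_zero.1 h.eq_zero

theorem isWeakDiv_weakDiv {v : G.VecL2} (hv : v ∈ G.Hdiv) : G.IsWeakDiv v (G.weakDiv v) := by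
  have h : ∃ g, G.IsWeakDiv v g := hv
  rw [weakDiv, dif_pos h]
  exact h.choose_spec

theorem IsWeakDiv.weakDiv_eq {v : G.VecL2} {p : G.Q} (h : G.IsWeakDiv v p) : G.weakDiv v = p :=
  (isWeakDiv_weakDiv ⟨p, h⟩).unique h

/-- `H(div; D)` as a subspace of `L²(D; ℝᵈ)`. -/
def HdivSubmodule (G : TwoGrid d) : Submodule ℝ G.VecL2 where
  carrier := G.Hdiv
  add_mem' := fun ⟨p, hp⟩ ⟨q, hq⟩ => ⟨p + q, hp.add hq⟩
  zero_mem' := ⟨0, G.isWeakDiv_zero⟩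
  smul_mem' := fun c _ ⟨p, hp⟩ => ⟨c • p, hp.smul c⟩

theorem weakDiv_zero (G : TwoGrid d) : G.weakDiv 0 = 0 := G.isWeakDiv_zero.weakDiv_eq

theorem weakDiv_add {v w : G.VecL2} (hv : v ∈ G.HdivSubmodule) (hw : w ∈ G.HdivSubmodule) :
    G.weakDiv (v + w) = G.weakDiv v + G.weakDiv w :=
  ((isWeakDiv_weakDiv hv).add (isWeakDiv_weakDiv hw)).weakDiv_eq

theorem weakDiv_smul {v : G.VecL2} (c : ℝ) (hv : v ∈ G.HdivSubmodule) :
    G.weakDiv (c • v) = c • G.weakDiv v :=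
  ((isWeakDiv_weakDiv hv).smul c).weakDiv_eq

theorem weakDiv_sub {v w : G.VecL2} (hv : v ∈ G.HdivSubmodule) (hw : w ∈ G.HdivSubmodule) :
    G.weakDiv (v - w) = G.weakDiv v - G.weakDiv w := by
  rw [sub_eq_add_neg, ← neg_one_smul ℝ w, weakDiv_add hv (Submodule.smul_mem _ _ hw),
    weakDiv_smul _ hw, neg_one_smul, sub_eq_add_neg]

/-- The divergence is local: a test function supported in `U ∩ D` sees the field only where it
vanishes. -/
theorem weakDiv_ae_eq_zero_of_ae_eq_zero {v : G.VecL2} (hv : v ∈ G.HdivSubmodule)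
    {U : Set (Euc d)} (hU : IsOpen U) (h : ∀ᵐ x ∂G.vol, x ∈ U → v x = 0) :
    ∀ᵐ x ∂G.vol, x ∈ U → G.weakDiv v x = 0 := by
  have := ae_eq_zero_of_integral_test_eq_zero (G.weakDiv v) (hU.inter G.isOpen_domain)
    fun φ hφ hs => by
      have h0 : ∫ x, inner ℝ (v x) (gradient φ x) ∂G.vol = 0 := by
        refine integral_eq_zero_of_ae ?_
        filter_upwards [h] with x hx
        by_cases hxU : x ∈ U
        · simp [hx hxU]
        · have hxs : x ∉ tsupport φ := fun hx' => hxU (hs hx').1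
          have : gradient φ x = 0 := by
            rw [gradient, fderiv_of_notMem_tsupport (𝕜 := ℝ) hxs, map_zero]
          simp [this]
      linarith [isWeakDiv_weakDiv hv φ hφ (hs.trans inter_subset_right)]
  filter_upwards [this, G.ae_mem_domain] with x hx hd hxU using hx ⟨hxU, hd⟩

/-! ### Normal traces -/

theorem integrable_green (v : G.VecL2) {φ : Euc d → ℝ} (hφ : IsTest φ) :
    Integrable (fun x => inner ℝ (v x) (gradient φ x) + G.weakDiv v x * φ x) G.vol :=
  (integrable_inner_gradient v hφ).add (integrable_mul_test _ hφ)

theorem integrableOn_mul_test {S : Set (Euc d)} {γ : Euc d → ℝ} {μ : Measure (Euc d)}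
    (hγ : IntegrableOn γ S μ) {φ : Euc d → ℝ} (hφ : IsTest φ) :
    IntegrableOn (fun x => γ x * φ x) S μ := by
  obtain ⟨C, hC⟩ := hφ.1.continuous.bounded_above_of_compact_support hφ.2
  exact hγ.mul_bdd (c := C) hφ.1.continuous.aestronglyMeasurable (ae_of_all _ hC)

theorem HasNormalTrace.add {i : Fin G.coarse.N} {v w : G.VecL2} {γ δ : Euc d → ℝ}
    (hv : v ∈ G.HdivSubmodule) (hw : w ∈ G.HdivSubmodule)
    (hγ : G.HasNormalTrace i v γ) (hδ : G.HasNormalTrace i w δ) :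
    G.HasNormalTrace i (v + w) (γ + δ) := by
  refine ⟨hγ.1.add hδ.1, fun φ hφ => ?_⟩
  have h1 : ∫ x in G.K i, (inner ℝ ((v + w : G.VecL2) x) (gradient φ x)
        + G.weakDiv (v + w) x * φ x) ∂G.vol
      = ∫ x in G.K i, ((inner ℝ (v x) (gradient φ x) + G.weakDiv v x * φ x)
        + (inner ℝ (w x) (gradient φ x) + G.weakDiv w x * φ x)) ∂G.vol := by
    refine integral_congr_ae (ae_restrict_of_ae ?_)
    filter_upwards [Lp.coeFn_add v w, Lp.coeFn_add (G.weakDiv v) (G.weakDiv w)] with x hx hx'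
    rw [weakDiv_add hv hw, hx, hx', Pi.add_apply, Pi.add_apply, inner_add_left]
    ring
  rw [h1, integral_add (integrable_green v hφ).integrableOn (integrable_green w hφ).integrableOn,
    hγ.2 φ hφ, hδ.2 φ hφ, ← integral_add (integrableOn_mul_test hγ.1 hφ)
      (integrableOn_mul_test hδ.1 hφ)]
  simp only [Pi.add_apply, add_mul]

theorem HasNormalTrace.smul {i : Fin G.coarse.N} {v : G.VecL2} {γ : Euc d → ℝ} (c : ℝ)
    (hv : v ∈ G.HdivSubmodule) (hγ : G.HasNormalTrace i v γ) :
    G.HasNormalTrace i (c • v) (c • γ) := by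
  refine ⟨hγ.1.smul c, fun φ hφ => ?_⟩
  have h1 : ∫ x in G.K i, (inner ℝ ((c • v : G.VecL2) x) (gradient φ x)
        + G.weakDiv (c • v) x * φ x) ∂G.vol
      = ∫ x in G.K i, c * (inner ℝ (v x) (gradient φ x) + G.weakDiv v x * φ x) ∂G.vol := by
    refine integral_congr_ae (ae_restrict_of_ae ?_)
    filter_upwards [Lp.coeFn_smul c v, Lp.coeFn_smul c (G.weakDiv v)] with x hx hx'
    rw [weakDiv_smul c hv, hx, hx', Pi.smul_apply, Pi.smul_apply, real_inner_smul_left,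
      smul_eq_mul]
    ring
  rw [h1, integral_const_mul, hγ.2 φ hφ, ← integral_const_mul]
  simp only [Pi.smul_apply, smul_eq_mul, mul_assoc]

theorem hasNormalTrace_zero (i : Fin G.coarse.N) : G.HasNormalTrace i 0 0 := by
  refine ⟨integrableOn_zero, fun φ _ => ?_⟩
  have h1 : ∫ x in G.K i, (inner ℝ ((0 : G.VecL2) x) (gradient φ x)
        + G.weakDiv 0 x * φ x) ∂G.vol = 0 := by
    refine integral_eq_zero_of_ae (ae_restrict_of_ae ?_)
    filter_upwards [Lp.coeFn_zero (Euc d) 2 G.vol, Lp.coeFn_zero ℝ 2 G.vol] with x hx hx'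
    rw [weakDiv_zero, hx, hx']
    simp
  rw [h1]
  simp

/-- Both traces represent the same functional of the test function, the volume side of Green's
formula, and smooth compactly supported functions separate locally integrable ones. -/
theorem HasNormalTrace.ae_eq {i : Fin G.coarse.N} {v : G.VecL2} {γ δ : Euc d → ℝ}
    (hγ : G.HasNormalTrace i v γ) (hδ : G.HasNormalTrace i v δ) :
    ∀ᵐ x ∂(G.surf.restrict (frontier (G.K i))), γ x = δ x := by
  refine ae_eq_of_integral_contDiff_smul_eq (Integrable.locallyIntegrable hγ.1)
    (Integrable.locallyIntegrable hδ.1) fun φ h1 h2 => ?_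
  simp only [smul_eq_mul, mul_comm (φ _)]
  rw [← hγ.2 φ ⟨h1, h2⟩, hδ.2 φ ⟨h1, h2⟩]

theorem outSign_eq (i : Fin G.coarse.N) (E : G.CoarseFace) (m : Euc d) :
    G.outSign i E m = 1 ∨ G.outSign i E m = -1 := by
  unfold outSign
  split_ifs <;> simp

theorem outSign_mul_self (i : Fin G.coarse.N) (E : G.CoarseFace) (m : Euc d) :
    G.outSign i E m * G.outSign i E m = 1 := by
  rcases outSign_eq i E m with h | h <;> simp [h]

variable {E : G.CoarseFace} {m : Euc d}

theorem HasNormalComponent.add {v w : G.VecL2} {g h : Euc d → ℝ}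
    (hv : v ∈ G.HdivSubmodule) (hw : w ∈ G.HdivSubmodule)
    (hg : G.HasNormalComponent E m v g) (hh : G.HasNormalComponent E m w h) :
    G.HasNormalComponent E m (v + w) (g + h) := fun i hi => by
  obtain ⟨γ, hγ, eγ⟩ := hg i hi
  obtain ⟨δ, hδ, eδ⟩ := hh i hi
  refine ⟨γ + δ, hγ.add hv hw hδ, ?_⟩
  filter_upwards [eγ, eδ] with x h1 h2
  rw [Pi.add_apply, Pi.add_apply, h1, h2, mul_add]

theorem HasNormalComponent.smul {v : G.VecL2} {g : Euc d → ℝ} (c : ℝ)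
    (hv : v ∈ G.HdivSubmodule) (hg : G.HasNormalComponent E m v g) :
    G.HasNormalComponent E m (c • v) (c • g) := fun i hi => by
  obtain ⟨γ, hγ, eγ⟩ := hg i hi
  refine ⟨c • γ, hγ.smul c hv, ?_⟩
  filter_upwards [eγ] with x h1
  rw [Pi.smul_apply, Pi.smul_apply, h1, smul_eq_mul, smul_eq_mul, mul_left_comm]

theorem HasNormalComponent.sub_smul {v w : G.VecL2} {g h : Euc d → ℝ} (c : ℝ)
    (hv : v ∈ G.HdivSubmodule) (hw : w ∈ G.HdivSubmodule)
    (hg : G.HasNormalComponent E m v g) (hh : G.HasNormalComponent E m w h) :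
    G.HasNormalComponent E m (v - c • w) (g - c • h) := by
  have := hg.add hv (Submodule.smul_mem _ (-c) hw) (hh.smul (-c) hw)
  rwa [neg_smul, neg_smul, ← sub_eq_add_neg, ← sub_eq_add_neg] at this

theorem hasNormalComponent_zero : G.HasNormalComponent E m 0 0 := fun i _ =>
  ⟨0, hasNormalTrace_zero i, by simp⟩

theorem HasNormalComponent.integrableOn {v : G.VecL2} {g : Euc d → ℝ}
    (hg : G.HasNormalComponent E m v g) : IntegrableOn g (E : Set (Euc d)) G.surf := by
  obtain ⟨i, hi, hf⟩ := E.2.exists_cell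
  obtain ⟨γ, hγ, eγ⟩ := hg i hi
  refine ((hγ.1.mono_set hf).const_mul (G.outSign i E m)).congr ?_
  filter_upwards [eγ] with x hx
  rw [hx, ← mul_assoc, outSign_mul_self, one_mul]

/-- Uniqueness of the trace on the boundary of one adjacent cell restricts to the face, and the sign
`outSign` cancels since its square is 1. Total flux therefore does not depend on the representative.
-/
theorem HasNormalComponent.ae_eq {v : G.VecL2} {g h : Euc d → ℝ}
    (hg : G.HasNormalComponent E m v g) (hh : G.HasNormalComponent E m v h) :
    ∀ᵐ x ∂(G.surf.restrict (E : Set (Euc d))), g x = h x := by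
  obtain ⟨i, hi, hf⟩ := E.2.exists_cell
  obtain ⟨γ, hγ, eγ⟩ := hg i hi
  obtain ⟨δ, hδ, eδ⟩ := hh i hi
  filter_upwards [eγ, eδ, ae_restrict_of_ae_restrict_of_subset hf (hγ.ae_eq hδ)] with x h1 h2 h3
  rw [h1, h2] at h3
  have := congrArg (G.outSign i E m * ·) h3
  simpa only [← mul_assoc, outSign_mul_self, one_mul] using this

end TwoGrid

namespace TwoGrid

variable {d : ℕ} {G : TwoGrid d}

/-! ### Bilinear forms -/

section Forms

variable {κ : Euc d → ℝ} {κmin : ℝ}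

theorem integrable_energy (hm : Measurable κ) (hpos : 0 < κmin)
    (hκ : ∀ᵐ x ∂G.vol, κmin ≤ κ x) (v w : G.VecL2) :
    Integrable (fun x => (κ x)⁻¹ * inner ℝ (v x) (w x)) G.vol := by
  refine (L2.integrable_inner (𝕜 := ℝ) v w).bdd_mul (c := κmin⁻¹)
    hm.inv.aestronglyMeasurable ?_
  filter_upwards [hκ] with x hx
  rw [Real.norm_eq_abs, abs_of_pos (inv_pos.2 (hpos.trans_le hx))]
  exact inv_anti₀ hpos hx

theorem a_comm (v w : G.VecL2) : G.a κ v w = G.a κ w v := by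
  simp only [a, real_inner_comm]

theorem a_add_left (hm : Measurable κ) (hpos : 0 < κmin)
    (hκ : ∀ᵐ x ∂G.vol, κmin ≤ κ x) (v v' w : G.VecL2) :
    G.a κ (v + v') w = G.a κ v w + G.a κ v' w := by
  rw [a, a, a, ← integral_add (integrable_energy hm hpos hκ v w)
    (integrable_energy hm hpos hκ v' w)]
  refine integral_congr_ae ?_
  filter_upwards [Lp.coeFn_add v v'] with x hx
  rw [hx, Pi.add_apply, inner_add_left, mul_add]

theorem a_smul_left (c : ℝ) (v w : G.VecL2) : G.a κ (c • v) w = c * G.a κ v w := by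
  rw [a, a, ← integral_const_mul]
  refine integral_congr_ae ?_
  filter_upwards [Lp.coeFn_smul c v] with x hx
  rw [hx, Pi.smul_apply, real_inner_smul_left, mul_left_comm]

theorem eq_zero_of_a_self_eq_zero (hm : Measurable κ) (hpos : 0 < κmin)
    (hκ : ∀ᵐ x ∂G.vol, κmin ≤ κ x) {v : G.VecL2} (h : G.a κ v v = 0) : v = 0 := by
  have hn : 0 ≤ᵐ[G.vol] fun x => (κ x)⁻¹ * inner ℝ (v x) (v x) := by
    filter_upwards [hκ] with x hx
    exact mul_nonneg (inv_nonneg.2 (hpos.trans_le hx).le) real_inner_self_nonneg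
  rw [a, integral_eq_zero_iff_of_nonneg_ae hn (integrable_energy hm hpos hκ v v)] at h
  rw [Lp.eq_zero_iff_ae_eq_zero]
  filter_upwards [h, hκ] with x hx hκx
  exact inner_self_eq_zero.1
    ((mul_eq_zero.1 hx).resolve_left (inv_pos.2 (hpos.trans_le hκx)).ne')

/-- The energy form `a` as a bilinear form. -/
noncomputable def energyForm (G : TwoGrid d) (hm : Measurable κ) (hpos : 0 < κmin)
    (hκ : ∀ᵐ x ∂G.vol, κmin ≤ κ x) : LinearMap.BilinForm ℝ G.VecL2 :=
  LinearMap.mk₂ ℝ (G.a κ) (a_add_left hm hpos hκ) a_smul_left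
    (fun v w w' => by rw [a_comm, a_add_left hm hpos hκ, a_comm w, a_comm w'])
    (fun c v w => by rw [a_comm, a_smul_left, a_comm w, smul_eq_mul])

theorem b_sub_left {v w : G.VecL2} (hv : v ∈ G.HdivSubmodule) (hw : w ∈ G.HdivSubmodule)
    (q : G.Q) : G.b (v - w) q = G.b v q - G.b w q := by
  rw [b, b, b, ← integral_sub (integrable_mul_of_memLp q (Lp.memLp _))
    (integrable_mul_of_memLp q (Lp.memLp _)), weakDiv_sub hv hw]
  refine integral_congr_ae ?_
  filter_upwards [Lp.coeFn_sub (G.weakDiv v) (G.weakDiv w)] with x hx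
  rw [hx, Pi.sub_apply, mul_sub]

theorem b_eq_zero_of_weakDiv_eq_zero {v : G.VecL2} (h : G.weakDiv v = 0) (q : G.Q) :
    G.b v q = 0 := by
  refine integral_eq_zero_of_ae ?_
  filter_upwards [Lp.coeFn_zero ℝ 2 G.vol] with x hx
  rw [h, hx, Pi.zero_apply, mul_zero]

end Forms

/-! ### Snapshot spaces -/

section Snapshots

variable {κ : Euc d → ℝ} {m : G.CoarseFace → Euc d}
  {ψ : ∀ E : G.CoarseFace, G.FineFace E → G.VecL2} {p : ∀ E : G.CoarseFace, G.FineFace E → G.Q}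

theorem isClosed_nbhd (E : G.CoarseFace) : IsClosed (G.nbhd E) :=
  (Set.toFinite {i | (E : Set (Euc d)) ⊆ G.K i}).isClosed_biUnion
    fun i _ => (G.coarse.isCompact_cell i).isClosed

theorem IsSnapshot.hasNormalComponent {E : G.CoarseFace} {n : Euc d} {e : G.FineFace E}
    {v : G.VecL2} {q : G.Q} (h : G.IsSnapshot κ E n e v q) :
    G.HasNormalComponent E n v (G.fluxDatum e) := fun i hi =>
  ⟨_, h.normal_trace i hi, by
    filter_upwards [ae_restrict_mem E.2.isClosed.measurableSet] with x hx
    rw [indicator_of_mem hx]⟩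

/-- The fields supported in `ω_E` that have an integrable normal component on `E` and whose
divergence on each coarse element of `ω_E` is the constant compatible with the total flux. -/
structure IsBalanced (E : G.CoarseFace) (n : Euc d) (v : G.VecL2) (g : Euc d → ℝ) : Prop where
  mem_Hdiv : v ∈ G.HdivSubmodule
  support : ∀ᵐ x ∂G.vol, x ∉ G.nbhd E → v x = 0
  component : G.HasNormalComponent E n v g
  divergence : ∀ i, (E : Set (Euc d)) ⊆ G.K i → ∀ᵐ x ∂G.vol, x ∈ G.K i →
    G.weakDiv v x = (volume (G.K i)).toReal⁻¹ *
      (G.outSign i E n * ∫ y in (E : Set (Euc d)), g y ∂G.surf)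

/-- The conditions are linear in the pair of field and flux density, so the density is carried along
as a witness through the span; for a generator it is the flux datum. -/
theorem exists_isBalanced (hsnap : ∀ E e, G.IsSnapshot κ E (m E) e (ψ E e) (p E e))
    {E : G.CoarseFace} {v : G.VecL2} (hv : v ∈ G.VsnapLoc ψ E) :
    ∃ g, IsBalanced E (m E) v g := by
  refine Submodule.span_induction (p := fun v _ => ∃ g, IsBalanced E (m E) v g) ?_ ?_ ?_ ?_ hv
  · rintro _ ⟨e, rfl⟩
    have h := hsnap E e
    exact ⟨_, h.mem_V₀.1, h.velocity_support, h.hasNormalComponent, h.divergence⟩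
  · refine ⟨0, Submodule.zero_mem _, ?_, hasNormalComponent_zero, fun i _ => ?_⟩
    · filter_upwards [Lp.coeFn_zero (Euc d) 2 G.vol] with x hx _
      rw [hx, Pi.zero_apply]
    · filter_upwards [Lp.coeFn_zero ℝ 2 G.vol] with x hx _
      rw [weakDiv_zero, hx]
      simp
  · rintro v w - - ⟨g, hg⟩ ⟨h, hh⟩
    refine ⟨g + h, Submodule.add_mem _ hg.mem_Hdiv hh.mem_Hdiv, ?_,
      hg.component.add hg.mem_Hdiv hh.mem_Hdiv hh.component, fun i hi => ?_⟩
    · filter_upwards [Lp.coeFn_add v w, hg.support, hh.support] with x hx h1 h2 hn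
      rw [hx, Pi.add_apply, h1 hn, h2 hn, add_zero]
    · filter_upwards [Lp.coeFn_add (G.weakDiv v) (G.weakDiv w), hg.divergence i hi,
        hh.divergence i hi] with x hx h1 h2 hK
      simp only [Pi.add_apply]
      rw [weakDiv_add hg.mem_Hdiv hh.mem_Hdiv, hx, Pi.add_apply, h1 hK, h2 hK,
        integral_add hg.component.integrableOn hh.component.integrableOn]
      ring
  · rintro c v - ⟨g, hg⟩
    refine ⟨c • g, Submodule.smul_mem _ c hg.mem_Hdiv, ?_, hg.component.smul c hg.mem_Hdiv,
      fun i hi => ?_⟩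
    · filter_upwards [Lp.coeFn_smul c v, hg.support] with x hx h1 hn
      rw [hx, Pi.smul_apply, h1 hn, smul_zero]
    · filter_upwards [Lp.coeFn_smul c (G.weakDiv v), hg.divergence i hi] with x hx h1 hK
      simp only [Pi.smul_apply, smul_eq_mul]
      rw [weakDiv_smul c hg.mem_Hdiv, hx, Pi.smul_apply, smul_eq_mul, h1 hK,
        integral_const_mul]
      ring

/-- A balanced field without total flux is divergence free. -/
theorem IsBalanced.weakDiv_eq_zero {E : G.CoarseFace} {n : Euc d} {v : G.VecL2} {g : Euc d → ℝ}
    (h : IsBalanced E n v g) (hg : ∫ y in (E : Set (Euc d)), g y ∂G.surf = 0) :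
    G.weakDiv v = 0 := by
  rw [Lp.eq_zero_iff_ae_eq_zero]
  have h1 : ∀ᵐ x ∂G.vol, ∀ i, (E : Set (Euc d)) ⊆ G.K i → x ∈ G.K i → G.weakDiv v x = 0 := by
    rw [ae_all_iff]
    intro i
    by_cases hi : (E : Set (Euc d)) ⊆ G.K i
    · filter_upwards [h.divergence i hi] with x hx _ hK
      rw [hx hK, hg, mul_zero, mul_zero]
    · exact ae_of_all _ fun _ h' => absurd h' hi
  -- Outside the closed neighbourhood the field vanishes on an open set, so locality of the
  -- divergence applies there.
  filter_upwards [h1, weakDiv_ae_eq_zero_of_ae_eq_zero h.mem_Hdiv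
    (isClosed_nbhd E).isOpen_compl h.support] with x hx hx'
  by_cases hn : x ∈ G.nbhd E
  · obtain ⟨i, hi, hK⟩ := mem_iUnion₂.1 hn
    exact hx i hi hK
  · exact hx' hn

theorem VsnapLoc_le_HdivSubmodule
    (hsnap : ∀ E e, G.IsSnapshot κ E (m E) e (ψ E e) (p E e)) (E : G.CoarseFace) :
    G.VsnapLoc ψ E ≤ G.HdivSubmodule := fun _ hv =>
  let ⟨_, h⟩ := exists_isBalanced hsnap hv
  h.mem_Hdiv

theorem Vsnap_le_HdivSubmodule
    (hsnap : ∀ E e, G.IsSnapshot κ E (m E) e (ψ E e) (p E e)) :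
    G.Vsnap ψ ≤ G.HdivSubmodule :=
  iSup_le (VsnapLoc_le_HdivSubmodule hsnap)

/-- The divergence free fields. -/
def divFree (G : TwoGrid d) : Submodule ℝ G.VecL2 where
  carrier := {v | v ∈ G.HdivSubmodule ∧ G.weakDiv v = 0}
  add_mem' := fun hv hw => ⟨Submodule.add_mem _ hv.1 hw.1, by
    rw [weakDiv_add hv.1 hw.1, hv.2, hw.2, add_zero]⟩
  zero_mem' := ⟨Submodule.zero_mem _, G.weakDiv_zero⟩
  smul_mem' := fun c _ hv => ⟨Submodule.smul_mem _ c hv.1, by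
    rw [weakDiv_smul c hv.1, hv.2, smul_zero]⟩

theorem Vsnap2Loc_le_VsnapLoc (E : G.CoarseFace) : G.Vsnap2Loc m ψ E ≤ G.VsnapLoc ψ E :=
  Submodule.span_le.2 fun _ hv => hv.1

theorem Vsnap2Loc_le_divFree
    (hsnap : ∀ E e, G.IsSnapshot κ E (m E) e (ψ E e) (p E e)) (E : G.CoarseFace) :
    G.Vsnap2Loc m ψ E ≤ G.divFree := by
  refine Submodule.span_le.2 ?_
  rintro v ⟨hv, h, hh, h0⟩
  obtain ⟨g, hg⟩ := exists_isBalanced hsnap hv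
  refine ⟨hg.mem_Hdiv, hg.weakDiv_eq_zero ?_⟩
  -- The density with zero integral and the one in the divergence formula come from different
  -- sources; uniqueness identifies them.
  rw [integral_congr_ae (hg.component.ae_eq hh), h0]

theorem VsnapLoc_le_span_sup_Vsnap2Loc
    (hsnap : ∀ E e, G.IsSnapshot κ E (m E) e (ψ E e) (p E e)) {E : G.CoarseFace}
    {v₁ : G.VecL2} (h₁ : v₁ ∈ G.VsnapLoc ψ E) (h₁' : G.HasNormalComponent E (m E) v₁ 1) :
    G.VsnapLoc ψ E ≤ Submodule.span ℝ {v₁} ⊔ G.Vsnap2Loc m ψ E := by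
  intro v hv
  obtain ⟨g, hg⟩ := exists_isBalanced hsnap hv
  -- Finite area of the face is read off from the integrability of the constant normal component 1
  -- of `v₁`.
  have hfin : G.surf (E : Set (Euc d)) < ⊤ := by
    have h := h₁'.integrableOn
    change IntegrableOn (fun _ => (1 : ℝ)) _ _ at h
    simpa [integrableOn_const_iff] using h
  have hne : G.surf.real (E : Set (Euc d)) ≠ 0 :=
    (ENNReal.toReal_pos E.2.measure_pos.ne' hfin.ne).ne'
  -- The mean flux density of `v`: subtracting `c • v₁` leaves total flux zero.
  set c : ℝ := (∫ y in (E : Set (Euc d)), g y ∂G.surf) / G.surf.real (E : Set (Euc d)) with hc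
  refine Submodule.mem_sup.2 ⟨c • v₁, Submodule.mem_span_singleton.2 ⟨c, rfl⟩, v - c • v₁,
    Submodule.subset_span ⟨Submodule.sub_mem _ hv (Submodule.smul_mem _ c h₁), g - c • 1,
      hg.component.sub_smul c hg.mem_Hdiv (VsnapLoc_le_HdivSubmodule hsnap E h₁) h₁', ?_⟩, by abel⟩
  have hint : ∫ x in (E : Set (Euc d)), (g - c • (1 : Euc d → ℝ)) x ∂G.surf
      = ∫ x in (E : Set (Euc d)), g x ∂G.surf
        - ∫ x in (E : Set (Euc d)), (c • (1 : Euc d → ℝ)) x ∂G.surf :=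
    integral_sub hg.component.integrableOn (h₁'.integrableOn.smul c)
  rw [hint]
  simp [hc, mul_div_cancel₀ _ hne]

end Snapshots

/-! ### The multiscale space -/

namespace OfflineBasis

variable {κ : Euc d → ℝ} {κmin : ℝ} {m : G.CoarseFace → Euc d}
  {ψ : ∀ E : G.CoarseFace, G.FineFace E → G.VecL2} {p : ∀ E : G.CoarseFace, G.FineFace E → G.Q}
  (B : OfflineBasis G κ m ψ)

theorem VsmsLoc_le_Vsnap2Loc (E : G.CoarseFace) : B.VsmsLoc E ≤ G.Vsnap2Loc m ψ E := by
  refine Submodule.span_le.2 ?_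
  rintro _ ⟨j, rfl⟩
  exact (B.eigen E _).1

theorem VsmsTildeLoc_le_Vsnap2Loc (E : G.CoarseFace) : B.VsmsTildeLoc E ≤ G.Vsnap2Loc m ψ E :=
  Submodule.span_le.2 fun _ hv => hv.1

theorem VsmsTilde_le_Vsnap : B.VsmsTilde ≤ G.Vsnap ψ :=
  iSup_mono fun E => (B.VsmsTildeLoc_le_Vsnap2Loc E).trans (Vsnap2Loc_le_VsnapLoc E)

theorem VsmsTilde_le_divFree
    (hsnap : ∀ E e, G.IsSnapshot κ E (m E) e (ψ E e) (p E e)) : B.VsmsTilde ≤ G.divFree :=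
  iSup_le fun E => (B.VsmsTildeLoc_le_Vsnap2Loc E).trans (Vsnap2Loc_le_divFree hsnap E)

theorem basisFn_mem_Vsnap (E : G.CoarseFace) (j : Option (Fin (B.J E))) :
    B.basisFn E j ∈ G.Vsnap ψ := by
  refine Submodule.mem_iSup_of_mem E ?_
  cases j with
  | none => exact B.φ₁_mem E
  | some j => exact Vsnap2Loc_le_VsnapLoc E (B.eigen E _).1

/-- The energy is definite and `VsmsLoc` is finite-dimensional, so the `a`-projection exists; its
remainder stays in `Vsnap2Loc`. -/
theorem Vsnap2Loc_le_VsmsLoc_sup_VsmsTildeLoc (hm : Measurable κ) (hpos : 0 < κmin)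
    (hκ : ∀ᵐ x ∂G.vol, κmin ≤ κ x) (E : G.CoarseFace) :
    G.Vsnap2Loc m ψ E ≤ B.VsmsLoc E ⊔ B.VsmsTildeLoc E := by
  intro v hv
  have : FiniteDimensional ℝ (B.VsmsLoc E) :=
    FiniteDimensional.span_of_finite ℝ (Set.finite_range _)
  obtain ⟨w, hw, h⟩ := (G.energyForm hm hpos hκ).exists_mem_forall_sub_eq_zero
    (fun _ h => eq_zero_of_a_self_eq_zero hm hpos hκ h) (B.VsmsLoc E) v
  exact Submodule.mem_sup.2 ⟨w, hw, v - w, Submodule.subset_span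
    ⟨Submodule.sub_mem _ hv (B.VsmsLoc_le_Vsnap2Loc E hw), h⟩, by abel⟩

variable {B} {c : ∀ E : G.CoarseFace, Option (Fin (B.J E)) → G.VecL2}

theorem IsCorrector.basisFn_mem (hc : B.IsCorrector c) (E : G.CoarseFace)
    (j : Option (Fin (B.J E))) : B.basisFn E j ∈ B.Vglo c ⊔ B.VsmsTilde :=
  Submodule.mem_sup.2 ⟨c E j + B.basisFn E j, Submodule.subset_span ⟨E, j, rfl⟩, -c E j,
    Submodule.neg_mem _ (hc E j).1, by abel⟩

theorem IsCorrector.Vglo_le_Vsnap (hc : B.IsCorrector c) : B.Vglo c ≤ G.Vsnap ψ := by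
  refine Submodule.span_le.2 ?_
  rintro _ ⟨E, j, rfl⟩
  exact Submodule.add_mem _ (B.VsmsTilde_le_Vsnap (hc E j).1) (B.basisFn_mem_Vsnap E j)

theorem IsCorrector.a_eq_zero (hc : B.IsCorrector c) (hm : Measurable κ) (hpos : 0 < κmin)
    (hκ : ∀ᵐ x ∂G.vol, κmin ≤ κ x) {v w : G.VecL2} (hv : v ∈ B.Vglo c) (hw : w ∈ B.VsmsTilde) :
    G.a κ v w = 0 := by
  -- Orthogonality to `w` is a linear condition, so it suffices to check the generators, where it is
  -- the corrector equation.
  have h : B.Vglo c ≤ LinearMap.ker ((G.energyForm hm hpos hκ).flip w) := by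
    refine Submodule.span_le.2 ?_
    rintro _ ⟨E, j, rfl⟩
    change G.a κ _ _ = 0
    rw [a_add_left hm hpos hκ, (hc E j).2 w hw, neg_add_cancel]
  exact h hv

theorem IsCorrector.Vsnap_le_Vglo_sup_VsmsTilde (hc : B.IsCorrector c)
    (hsnap : ∀ E e, G.IsSnapshot κ E (m E) e (ψ E e) (p E e)) (hm : Measurable κ)
    (hpos : 0 < κmin) (hκ : ∀ᵐ x ∂G.vol, κmin ≤ κ x) :
    G.Vsnap ψ ≤ B.Vglo c ⊔ B.VsmsTilde := by
  refine iSup_le fun E =>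
    (VsnapLoc_le_span_sup_Vsnap2Loc hsnap (B.φ₁_mem E) (B.φ₁_flux E)).trans (sup_le ?_ ?_)
  · rw [Submodule.span_singleton_le_iff_mem]
    exact hc.basisFn_mem E none
  · refine (B.Vsnap2Loc_le_VsmsLoc_sup_VsmsTildeLoc hm hpos hκ E).trans (sup_le ?_ ?_)
    · refine Submodule.span_le.2 ?_
      rintro _ ⟨j, rfl⟩
      exact hc.basisFn_mem E (some j)
    · exact (le_iSup B.VsmsTildeLoc E).trans le_sup_right

end OfflineBasis

end TwoGrid

/-! ### Equality of the two velocities. -/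

theorem mainTheorem5 {d : ℕ} (hd : d = 2 ∨ d = 3) (G : TwoGrid d)
    (κ : Euc d → ℝ) (κmin κmax : ℝ) (hκ_meas : Measurable κ) (hκ_pos : 0 < κmin)
    (hκ : ∀ᵐ x ∂G.vol, κmin ≤ κ x ∧ κ x ≤ κmax)
    (f : G.Q) (hf : ∫ x, f x ∂G.vol = 0)
    (m : G.CoarseFace → Euc d) (hm : ∀ E, G.IsUnitNormal E (m E))
    (ψsnap : ∀ E : G.CoarseFace, G.FineFace E → G.VecL2)
    (psnap : ∀ E : G.CoarseFace, G.FineFace E → G.Q)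
    (hsnap : ∀ E e, G.IsSnapshot κ E (m E) e (ψsnap E e) (psnap E e))
    (B : G.OfflineBasis κ m ψsnap)
    (ψcor : ∀ E : G.CoarseFace, Option (Fin (B.J E)) → G.VecL2) (hcor : B.IsCorrector ψcor)
    (u_snap u_glo : G.VecL2) (p_snap p_glo : G.Q)
    (h_snap : G.IsMixedSolution κ f (G.Vsnap ψsnap) u_snap p_snap)
    (h_glo : G.IsMixedSolution κ f (B.Vglo ψcor) u_glo p_glo) :
    u_snap = u_glo := by
  obtain ⟨hu, hp, hau, hbu⟩ := h_snap
  obtain ⟨hu', hp', hau', hbu'⟩ := h_glo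
  have hκ' : ∀ᵐ x ∂G.vol, κmin ≤ κ x := hκ.mono fun _ h => h.1
  have hadd := TwoGrid.a_add_left (G := G) hκ_meas hκ_pos hκ'
  have hzero {v : G.VecL2} (h : G.a κ v v = 0) : v = 0 :=
    TwoGrid.eq_zero_of_a_self_eq_zero hκ_meas hκ_pos hκ' h
  have hmem : u_snap ∈ B.Vglo ψcor := by
    obtain ⟨v, hv, t, ht, rfl⟩ := Submodule.mem_sup.1
      (hcor.Vsnap_le_Vglo_sup_VsmsTilde hsnap hκ_meas hκ_pos hκ' hu)
    -- Testing with `t` gives `a t t = 0`: the pressure term drops since `t` is divergence free, and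
    -- `a v t` drops by orthogonality.
    have h := hau t (B.VsmsTilde_le_Vsnap ht)
    rw [TwoGrid.b_eq_zero_of_weakDiv_eq_zero (B.VsmsTilde_le_divFree hsnap ht).2, sub_zero, hadd,
      hcor.a_eq_zero hκ_meas hκ_pos hκ' hv ht, zero_add] at h
    rwa [hzero h, add_zero]
  have hdiv := TwoGrid.Vsnap_le_HdivSubmodule hsnap
  have hb {q : G.Q} (hq : q ∈ G.QH) : G.b (u_snap - u_glo) q = 0 := by
    rw [TwoGrid.b_sub_left (hdiv hu) (hdiv (hcor.Vglo_le_Vsnap hu')), hbu q hq, hbu' q hq, sub_self]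
  have hw : u_snap - u_glo ∈ B.Vglo ψcor := Submodule.sub_mem _ hmem hu'
  -- The two pressures need not be compared: each lies in `QH`, where `b` of the difference
  -- vanishes.
  have h1 := hau _ (hcor.Vglo_le_Vsnap hw)
  have h2 := hau' _ hw
  rw [hb hp, sub_zero] at h1
  rw [hb hp', sub_zero] at h2
  have h3 := hadd (u_snap - u_glo) u_glo (u_snap - u_glo)
  rw [sub_add_cancel, h1, h2, add_zero] at h3
  exact sub_eq_zero.1 (hzero h3.symm)
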